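/- Let $(M_1,g_1)$ be a smooth Riemannian manifold (without boundary) with $\dim M_1>1$ and negative sectional curvature $K_1$ (all sectional curvatures are $<0$). Let $\nabla$ be its Levi-Civita connection and let $k:M_1\to\mathbb R$ be a $C^\infty$ function with $\inf_{M_1}k>0$. Put $k_1:=-1/\sup_{M_1}k$ if $k$ is bounded from above and $k_1:=0$ otherwise. For $r>k_1$ let $G_r:=\left(\frac1k+r\right)g_1$, which is a Riemannian metric on $M_1$. Let $r>k_1$ and suppose that for every $x\in M_1$, every $e\in T_xM_1$ with $g_1(e,e)=1$ and every two-dimensional subspace $\sigma\subseteq T_xM_1$ containing $e$, $$(\nabla dk)(e,e)<\frac{1+4rk}{2k(1+rk)}\,e(k)^2+\frac{1}{4k(1+rk)}\,\|dk\|_{g_1}^2-k(1+rk)\,K_1(\sigma),$$ where $k$ is evaluated at $x$. Then $G_r$ has negative sectional curvature. (In particular, if the inequality holds for every $r>k_1$, then $G_r$ has negative sectional curvature for every $r>k_1$.) -/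

import Mathlib

open Set Bundle
open scoped Manifold ContDiff

noncomputable section

/-! ### Riemannian geometry of a metric `G` given on an open subset of a vector space

`G y u v` is the scalar product at `y` of the vectors `u` and `v`. -/

section Local

variable {E : Type*} [NormedAddCommGroup E] [NormedSpace ℝ E]

/-- The Koszul form `w ↦ (∂ᵤ G(v, w) + ∂ᵥ G(u, w) - ∂_w G(u, v)) / 2`, that is, the Christoffel
symbols of the first kind. -/
def localKoszul (G : E → E →L[ℝ] E →L[ℝ] ℝ) (y u v : E) : E →L[ℝ] ℝ :=
  (1 / 2 : ℝ) •
    (fderiv ℝ G y u v + fderiv ℝ G y v u - ((fderiv ℝ G y).flip u).flip v)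

/-- The Christoffel symbols (of the second kind) `Γ(u, v)` of the Levi-Civita connection,
characterized by `G(Γ(u, v), w) = localKoszul G y u v w` for all `w`. -/
def localChristoffel (G : E → E →L[ℝ] E →L[ℝ] ℝ) (y u v : E) : E :=
  (G y).inverse (localKoszul G y u v)

/-- The curvature tensor `R(u, v) w = ∇ᵤ ∇ᵥ w - ∇ᵥ ∇ᵤ w` of the Levi-Civita connection,
where `u`, `v`, `w` are extended to constant vector fields (so that `[u, v] = 0`). -/
def localCurvature (G : E → E →L[ℝ] E →L[ℝ] ℝ) (y u v w : E) : E :=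
  fderiv ℝ (fun z => localChristoffel G z v w) y u
    - fderiv ℝ (fun z => localChristoffel G z u w) y v
    + localChristoffel G y u (localChristoffel G y v w)
    - localChristoffel G y v (localChristoffel G y u w)

/-- The Hessian `(∇ df)(u, v) = ∂ᵤ ∂ᵥ f - df(Γ(u, v))`. -/
def localHessian (G : E → E →L[ℝ] E →L[ℝ] ℝ) (f : E → ℝ) (y u v : E) : ℝ :=
  fderiv ℝ (fderiv ℝ f) y u v - fderiv ℝ f y (localChristoffel G y u v)

end Local

/-! ### Riemannian geometry of a smooth Riemannian metric on a manifold -/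

section Mfld

variable {E : Type*} [NormedAddCommGroup E] [NormedSpace ℝ E]
variable {M : Type*} [TopologicalSpace M] [ChartedSpace E M] [IsManifold 𝓘(ℝ, E) ∞ M]

variable (E M) in
/-- Smooth Riemannian metrics on `M`, a manifold without boundary modelled on `E`. -/
abbrev SmoothMetric : Type _ :=
  ContMDiffRiemannianMetric 𝓘(ℝ, E) ∞ E (fun x : M => TangentSpace 𝓘(ℝ, E) x)

/-- The metric `g` read in the preferred chart `φ` at `x`: the pullback of `g` by `φ⁻¹`. Only its
values on the target of `φ` are meaningful. -/
def SmoothMetric.inChart (g : SmoothMetric E M) (x : M) (y : E) : E →L[ℝ] E →L[ℝ] ℝ :=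
  let φ := extChartAt 𝓘(ℝ, E) x
  let D : E →L[ℝ] E := mfderiv 𝓘(ℝ, E) 𝓘(ℝ, E) φ.symm y
  let B : E →L[ℝ] E →L[ℝ] ℝ := g.inner (φ.symm y)
  B.bilinearComp D D

/-- The curvature tensor of the Levi-Civita connection of `g` at `x`, computed in the preferred
chart at `x`. A vector of `T_x M` is in Mathlib the same as its coordinate vector in this chart. -/
def SmoothMetric.curvature (g : SmoothMetric E M) (x : M)
    (u v w : TangentSpace 𝓘(ℝ, E) x) : TangentSpace 𝓘(ℝ, E) x :=
  localCurvature (E := E) (g.inChart x) (extChartAt 𝓘(ℝ, E) x x) u v w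

/-- The Hessian `∇ df` at `x` for the Levi-Civita connection of `g`, computed in the
preferred chart at `x`. -/
def SmoothMetric.hessian (g : SmoothMetric E M) (f : M → ℝ) (x : M)
    (u v : TangentSpace 𝓘(ℝ, E) x) : ℝ :=
  localHessian (E := E) (g.inChart x) (f ∘ (extChartAt 𝓘(ℝ, E) x).symm) (extChartAt 𝓘(ℝ, E) x x) u v

/-- The sectional curvature at `x` of the plane spanned by the linearly independent vectors
`u`, `v`. -/
def SmoothMetric.sectionalCurvature (g : SmoothMetric E M) (x : M)
    (u v : TangentSpace 𝓘(ℝ, E) x) : ℝ :=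
  g.inner x (g.curvature x u v v) u /
    (g.inner x u u * g.inner x v v - g.inner x u v ^ 2)

/-- All sectional curvatures of `g` are negative. -/
def SmoothMetric.HasNegativeSectionalCurvature (g : SmoothMetric E M) : Prop :=
  ∀ (x : M) (u v : TangentSpace 𝓘(ℝ, E) x), LinearIndependent ℝ ![u, v] →
    g.sectionalCurvature x u v < 0

/-- The `g`-gradient of `f` at `x`: the vector `w` with `g(w, ·) = df`. -/
def SmoothMetric.gradient (g : SmoothMetric E M) (f : M → ℝ) (x : M) :
    TangentSpace 𝓘(ℝ, E) x :=
  (g.inner x).inverse (mvfderiv 𝓘(ℝ, E) f x)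

/-- The square `‖df‖²` at `x` of the norm of the differential of `f` with respect to `g`. -/
def SmoothMetric.normSqDifferential (g : SmoothMetric E M) (f : M → ℝ) (x : M) : ℝ :=
  g.inner x (g.gradient f x) (g.gradient f x)

/-- The metric `h g`, for a smooth positive function `h`. -/
def SmoothMetric.conformal (g : SmoothMetric E M) (h : M → ℝ)
    (hh : ContMDiff 𝓘(ℝ, E) 𝓘(ℝ, ℝ) ∞ h) (hpos : ∀ x, 0 < h x) : SmoothMetric E M where
  inner x := h x • g.inner x
  symm x v w := by simp [g.symm x v w]
  pos x v hv := by simpa using mul_pos (hpos x) (g.pos x v hv)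
  isVonNBounded x := by
    have hb := (g.isVonNBounded x).image (σ := RingHom.id ℝ)
      ((Real.sqrt (h x))⁻¹ • ContinuousLinearMap.id ℝ (TangentSpace 𝓘(ℝ, E) x))
    refine hb.subset fun v hv => (mem_image _ _ _).2 ⟨Real.sqrt (h x) • v, ?_, ?_⟩
    · have h2 : Real.sqrt (h x) * (Real.sqrt (h x) * g.inner x v v) = h x * g.inner x v v := by
        rw [← mul_assoc, Real.mul_self_sqrt (hpos x).le]
      simpa [h2] using hv
    · have h3 : Real.sqrt (h x) ≠ 0 := (Real.sqrt_pos.2 (hpos x)).ne'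
      simp [smul_smul, h3]
  contMDiff := hh.smul_section g.contMDiff

end Mfld

/-! ### The metrics `G_r = (1 / k + r) g` -/

/-- The number `k₁`: it is `- 1 / sup k` if `k` is bounded from above, and `0` otherwise. -/
def lowerParameter {M : Type*} (k : M → ℝ) : ℝ :=
  open Classical in if BddAbove (range k) then -(⨆ x, k x)⁻¹ else 0

lemma inv_add_pos_of_lowerParameter_lt {M : Type*} {k : M → ℝ} (hpos : ∃ c > 0, ∀ x, c ≤ k x)
    {r : ℝ} (hr : lowerParameter k < r) (x : M) : 0 < 1 / k x + r := by
  obtain ⟨c, hc, hck⟩ := hpos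
  have hx : 0 < k x := hc.trans_le (hck x)
  unfold lowerParameter at hr
  split_ifs at hr with hb
  · have : (⨆ x, k x)⁻¹ ≤ (k x)⁻¹ := inv_anti₀ hx (le_ciSup hb x)
    rw [one_div]
    linarith
  · positivity

section Gr

variable {E : Type*} [NormedAddCommGroup E] [NormedSpace ℝ E]
variable {M : Type*} [TopologicalSpace M] [ChartedSpace E M] [IsManifold 𝓘(ℝ, E) ∞ M]

/-- The Riemannian metric `G_r = (1 / k + r) g`, for a smooth function `k` that is bounded from
below away from zero and for `r > k₁`. -/
def metricG (g : SmoothMetric E M) (k : M → ℝ) (hk : ContMDiff 𝓘(ℝ, E) 𝓘(ℝ, ℝ) ∞ k)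
    (hpos : ∃ c > 0, ∀ x, c ≤ k x) (r : ℝ) (hr : lowerParameter k < r) : SmoothMetric E M :=
  g.conformal (fun x => 1 / k x + r)
    (by
      obtain ⟨c, hc, hck⟩ := hpos
      simp only [one_div]
      exact (hk.inv₀ fun x => (hc.trans_le (hck x)).ne').add contMDiff_const)
    (inv_add_pos_of_lowerParameter_lt hpos hr)

/-- The Hessian inequality with parameter `r`: at each point `x`, for each `g`-unit vector `e` of
`T_x M` and each plane `σ` of `T_x M` containing `e` (here `σ` is spanned by `e` and `f`),
`(∇ dk)(e, e) < (1 + 4rk) / (2k(1 + rk)) e(k)² + 1 / (4k(1 + rk)) ‖dk‖² - k(1 + rk) K(σ)`. -/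
def HessianInequality (g : SmoothMetric E M) (k : M → ℝ) (r : ℝ) : Prop :=
  ∀ (x : M) (e f : TangentSpace 𝓘(ℝ, E) x), g.inner x e e = 1 → LinearIndependent ℝ ![e, f] →
    g.hessian k x e e <
      (1 + 4 * r * k x) / (2 * k x * (1 + r * k x)) * (mvfderiv 𝓘(ℝ, E) k x e) ^ 2
      + 1 / (4 * k x * (1 + r * k x)) * g.normSqDifferential k x
      - k x * (1 + r * k x) * g.sectionalCurvature x e f

end Gr

end

/-! Write the conformal factor as `H = 1 / k + r` and put `a = dH / (2H) = -dk / (2P)` with `P = k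
(1 + r k)`. If `H = exp (2φ)`, then `a = dφ`, so the classical conformal formula gives, for a
`g₁`-orthonormal pair `u, v`, with `R'` the curvature tensor of `G_r`, `g₁(R'(u,v)v, u) = K₁(u,v) -
(∇a)(u,u) - (∇a)(v,v) + a(u)² + a(v)² - ‖a‖²`. Substituting `a` and multiplying by `2P > 0` turns
the right side into exactly left minus right of the sum of two Hessian inequalities, one for `e = u`
and one for `e = v`, both in the plane of `u, v`. Hence it is negative, and pairing with `G_r`
instead of `g₁` only adds the factor `H > 0`.

The computation is done in coordinates: `localChristoffel_smul` compares the connections,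
`localCurvature_of_christoffel_eq` the curvatures, and `localCurvature_one_div_add_smul` inserts
`H`. The sign on `g₁`-orthonormal pairs suffices by `hasNegativeSectionalCurvature_of_orthonormal`.
-/

set_option synthInstance.maxSize 2000
set_option synthInstance.maxHeartbeats 1000000

open Filter Topology

/-! ### Levi-Civita connection and curvature in coordinates -/

section LocalMetric

variable {E : Type*} [NormedAddCommGroup E] [NormedSpace ℝ E]

/-- `G` is a smooth nondegenerate symmetric bilinear form near `y`. -/
structure IsLocalMetric (G : E → E →L[ℝ] E →L[ℝ] ℝ) (y : E) : Prop where
  contDiffAt : ContDiffAt ℝ 2 G y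
  eventually_symm : ∀ᶠ z in 𝓝 y, ∀ u v, G z u v = G z v u
  eventually_isInvertible : ∀ᶠ z in 𝓝 y, (G z).IsInvertible

lemma localKoszul_apply (G : E → E →L[ℝ] E →L[ℝ] ℝ) (y u v w : E) :
    localKoszul G y u v w =
      (fderiv ℝ G y u v w + fderiv ℝ G y v u w - fderiv ℝ G y w u v) / 2 := by
  simp [localKoszul]
  ring

section Christoffel

variable (G : E → E →L[ℝ] E →L[ℝ] ℝ) (y : E)

lemma localChristoffel_add_left (u u' v : E) :
    localChristoffel G y (u + u') v = localChristoffel G y u v + localChristoffel G y u' v := by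
  simp only [localChristoffel, ← map_add]
  congr 1
  ext w
  simp [localKoszul_apply]
  ring

lemma localChristoffel_add_right (u v v' : E) :
    localChristoffel G y u (v + v') = localChristoffel G y u v + localChristoffel G y u v' := by
  simp only [localChristoffel, ← map_add]
  congr 1
  ext w
  simp [localKoszul_apply]
  ring

lemma localChristoffel_smul_left (c : ℝ) (u v : E) :
    localChristoffel G y (c • u) v = c • localChristoffel G y u v := by
  simp only [localChristoffel, ← map_smul]
  congr 1
  ext w
  simp [localKoszul_apply]
  ring

lemma localChristoffel_smul_right (c : ℝ) (u v : E) :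
    localChristoffel G y u (c • v) = c • localChristoffel G y u v := by
  simp only [localChristoffel, ← map_smul]
  congr 1
  ext w
  simp [localKoszul_apply]
  ring

lemma localChristoffel_sub_right (u v v' : E) :
    localChristoffel G y u (v - v') = localChristoffel G y u v - localChristoffel G y u v' := by
  rw [sub_eq_add_neg, localChristoffel_add_right, ← neg_one_smul ℝ v',
    localChristoffel_smul_right, neg_one_smul, sub_eq_add_neg]

end Christoffel

lemma localCurvature_comm (G : E → E →L[ℝ] E →L[ℝ] ℝ) (y u v w : E) :
    localCurvature G y u v w = - localCurvature G y v u w := by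
  simp only [localCurvature]
  abel

namespace IsLocalMetric

variable {G : E → E →L[ℝ] E →L[ℝ] ℝ} {y : E}

/-- All three conditions are open, so identities proved at a point hold nearby and may be
differentiated. -/
lemma eventually_nhds (hG : IsLocalMetric G y) : ∀ᶠ z in 𝓝 y, IsLocalMetric G z := by
  filter_upwards [hG.contDiffAt.eventually (by simp), hG.eventually_symm.eventually_nhds,
    hG.eventually_isInvertible.eventually_nhds] with z h₁ h₂ h₃
  exact ⟨h₁, h₂, h₃⟩

lemma symm (hG : IsLocalMetric G y) (u v : E) : G y u v = G y v u :=
  hG.eventually_symm.self_of_nhds u v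

lemma isInvertible (hG : IsLocalMetric G y) : (G y).IsInvertible :=
  hG.eventually_isInvertible.self_of_nhds

lemma apply_inverse (hG : IsLocalMetric G y) (a : E →L[ℝ] ℝ) (w : E) :
    G y ((G y).inverse a) w = a w := by
  rw [hG.isInvertible.self_apply_inverse]

lemma eq_of_apply_eq (hG : IsLocalMetric G y) {x x' : E} (h : ∀ w, G y x w = G y x' w) :
    x = x' := by
  rw [← hG.isInvertible.inverse_apply_self x, ← hG.isInvertible.inverse_apply_self x']
  congr 1
  ext w
  exact h w

lemma hasFDerivAt (hG : IsLocalMetric G y) : HasFDerivAt G (fderiv ℝ G y) y :=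
  (hG.contDiffAt.differentiableAt (by simp)).hasFDerivAt

lemma fderiv_apply_apply (hG : IsLocalMetric G y) {X Y : E → E} {X' Y' : E →L[ℝ] E}
    (hX : HasFDerivAt X X' y) (hY : HasFDerivAt Y Y' y) (u : E) :
    fderiv ℝ (fun z => G z (X z) (Y z)) y u =
      fderiv ℝ G y u (X y) (Y y) + G y (X' u) (Y y) + G y (X y) (Y' u) := by
  rw [((hG.hasFDerivAt.clm_apply hX).clm_apply hY).fderiv]
  simp
  ring

lemma fderiv_apply (hG : IsLocalMetric G y) (u v w : E) :
    fderiv ℝ G y u v w = fderiv ℝ (fun z => G z v w) y u := by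
  rw [hG.fderiv_apply_apply (hasFDerivAt_const v y) (hasFDerivAt_const w y)]
  simp

lemma fderiv_symm (hG : IsLocalMetric G y) (u v w : E) :
    fderiv ℝ G y u v w = fderiv ℝ G y u w v := by
  rw [hG.fderiv_apply, hG.fderiv_apply]
  have h := hG.eventually_symm.mono fun z hz => hz v w
  exact DFunLike.congr_fun (EventuallyEq.fderiv_eq (𝕜 := ℝ) h) u

lemma apply_localChristoffel (hG : IsLocalMetric G y) (u v w : E) :
    G y (localChristoffel G y u v) w =
      (fderiv ℝ G y u v w + fderiv ℝ G y v u w - fderiv ℝ G y w u v) / 2 := by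
  rw [localChristoffel, hG.apply_inverse, localKoszul_apply]

lemma localChristoffel_comm (hG : IsLocalMetric G y) (u v : E) :
    localChristoffel G y u v = localChristoffel G y v u := by
  refine hG.eq_of_apply_eq fun w => ?_
  rw [hG.apply_localChristoffel, hG.apply_localChristoffel, hG.fderiv_symm w u v]
  ring

/-- The Levi-Civita connection is compatible with the metric. -/
lemma fderiv_eq (hG : IsLocalMetric G y) (u v w : E) :
    fderiv ℝ G y u v w =
      G y (localChristoffel G y u v) w + G y v (localChristoffel G y u w) := by
  rw [hG.symm v, hG.apply_localChristoffel, hG.apply_localChristoffel, hG.fderiv_symm u w v,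
    hG.fderiv_symm v u w, hG.fderiv_symm w u v]
  ring

lemma contDiffAt_apply (hG : IsLocalMetric G y) (v w : E) :
    ContDiffAt ℝ 2 (fun z => G z v w) y :=
  (hG.contDiffAt.clm_apply contDiffAt_const).clm_apply contDiffAt_const

lemma differentiableAt_fderiv_apply (hG : IsLocalMetric G y) (u v w : E) :
    DifferentiableAt ℝ (fun z => fderiv ℝ G z u v w) y := by
  have h : DifferentiableAt ℝ (fderiv ℝ fun z => G z v w) y :=
    ((hG.contDiffAt_apply v w).fderiv_right (m := 1) (by norm_num)).differentiableAt (by simp)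
  refine (h.clm_apply (differentiableAt_const u)).congr_of_eventuallyEq ?_
  exact hG.eventually_nhds.mono fun z hz => hz.fderiv_apply u v w

variable [FiniteDimensional ℝ E]

lemma differentiableAt_inverse (hG : IsLocalMetric G y) {a : E → E →L[ℝ] ℝ}
    (ha : DifferentiableAt ℝ a y) : DifferentiableAt ℝ (fun z => (G z).inverse (a z)) y := by
  have : CompleteSpace E := FiniteDimensional.complete ℝ E
  have h : DifferentiableAt ℝ (fun z => (G z).inverse) y :=
    ((hG.isInvertible.contDiffAt_map_inverse (n := 1)).differentiableAt (by simp)).comp y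
      hG.hasFDerivAt.differentiableAt
  exact h.clm_apply ha

/-- A basis of `E` identifies `E →L[ℝ] F` with a finite power of `F`. This serves the Koszul form,
whose values are easier to differentiate than the form itself. -/
lemma differentiableAt_clm_of_apply {F : Type*} [NormedAddCommGroup F] [NormedSpace ℝ F]
    {f : E → E →L[ℝ] F} (h : ∀ v, DifferentiableAt ℝ (fun z => f z v) y) :
    DifferentiableAt ℝ f y := by
  let d := Module.finrank ℝ E
  have hd : d = Module.finrank ℝ (Fin d → ℝ) := (Module.finrank_fin_fun ℝ).symm
  let e₁ := ContinuousLinearEquiv.ofFinrankEq hd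
  let e₂ := (e₁.arrowCongr (1 : F ≃L[ℝ] F)).trans (ContinuousLinearEquiv.piRing (Fin d))
  rw [← Function.id_comp f, ← e₂.symm_comp_self]
  exact e₂.symm.differentiableAt.comp y (differentiableAt_pi.mpr fun i => h _)

lemma differentiableAt_localChristoffel (hG : IsLocalMetric G y) (u v : E) :
    DifferentiableAt ℝ (fun z => localChristoffel G z u v) y := by
  refine hG.differentiableAt_inverse (differentiableAt_clm_of_apply fun w => ?_)
  simp only [localKoszul_apply, div_eq_mul_inv]
  exact (((hG.differentiableAt_fderiv_apply u v w).add (hG.differentiableAt_fderiv_apply v u w)).sub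
    (hG.differentiableAt_fderiv_apply w u v)).mul_const _

/-- Metric compatibility, valid near `y`, differentiated once more. -/
lemma fderiv_fderiv_apply (hG : IsLocalMetric G y) (x u v w : E) :
    fderiv ℝ (fderiv ℝ fun z => G z v w) y x u =
      G y (fderiv ℝ (fun z => localChristoffel G z u v) y x) w
      + G y v (fderiv ℝ (fun z => localChristoffel G z u w) y x)
      + fderiv ℝ G y x (localChristoffel G y u v) w
      + fderiv ℝ G y x v (localChristoffel G y u w) := by
  have h : (fun z => fderiv ℝ (fun z => G z v w) z u) =ᶠ[𝓝 y] fun z =>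
      G z (localChristoffel G z u v) w + G z v (localChristoffel G z u w) :=
    hG.eventually_nhds.mono fun z hz => by
      simpa only [hz.fderiv_apply] using hz.fderiv_eq u v w
  have h' := DFunLike.congr_fun (h.fderiv_eq (𝕜 := ℝ)) x
  have h₁ := (hG.differentiableAt_localChristoffel u v).hasFDerivAt
  have h₂ := (hG.differentiableAt_localChristoffel u w).hasFDerivAt
  have h₀ : DifferentiableAt ℝ (fderiv ℝ fun z => G z v w) y :=
    ((hG.contDiffAt_apply v w).fderiv_right (m := 1) (by norm_num)).differentiableAt (by simp)
  rw [(h₀.hasFDerivAt.clm_apply (hasFDerivAt_const u y)).fderiv, fderiv_fun_add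
    ((hG.hasFDerivAt.clm_apply h₁).clm_apply (hasFDerivAt_const w y)).differentiableAt
    ((hG.hasFDerivAt.clm_apply (hasFDerivAt_const v y)).clm_apply h₂).differentiableAt,
    add_apply (fderiv ℝ _ y), hG.fderiv_apply_apply h₁ (hasFDerivAt_const w y),
    hG.fderiv_apply_apply (hasFDerivAt_const v y) h₂] at h'
  simp at h'
  linarith

/-- The second derivatives of `G(w, x)` in the directions `u`, `v` commute. After expansion by
compatibility the products of two Christoffel terms cancel, and what remains is the curvature. -/
lemma localCurvature_skew (hG : IsLocalMetric G y) (u v w x : E) :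
    G y (localCurvature G y u v w) x = - G y w (localCurvature G y u v x) := by
  have h := ((hG.contDiffAt_apply w x).isSymmSndFDerivAt (by simp)).eq u v
  simp only [hG.fderiv_fderiv_apply, hG.fderiv_eq] at h
  simp only [localCurvature, map_add, map_sub, add_apply, sub_apply]
  linarith

lemma fderiv_localChristoffel_add_left (hG : IsLocalMetric G y) (u v w : E) :
    fderiv ℝ (fun z => localChristoffel G z (u + v) w) y =
      fderiv ℝ (fun z => localChristoffel G z u w) y
        + fderiv ℝ (fun z => localChristoffel G z v w) y := by
  simp only [localChristoffel_add_left]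
  exact fderiv_fun_add (hG.differentiableAt_localChristoffel u w)
    (hG.differentiableAt_localChristoffel v w)

lemma fderiv_localChristoffel_add_right (hG : IsLocalMetric G y) (u v w : E) :
    fderiv ℝ (fun z => localChristoffel G z u (v + w)) y =
      fderiv ℝ (fun z => localChristoffel G z u v) y
        + fderiv ℝ (fun z => localChristoffel G z u w) y := by
  simp only [localChristoffel_add_right]
  exact fderiv_fun_add (hG.differentiableAt_localChristoffel u v)
    (hG.differentiableAt_localChristoffel u w)

lemma fderiv_localChristoffel_smul_left (hG : IsLocalMetric G y) (c : ℝ) (u v : E) :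
    fderiv ℝ (fun z => localChristoffel G z (c • u) v) y =
      c • fderiv ℝ (fun z => localChristoffel G z u v) y := by
  simp only [localChristoffel_smul_left]
  exact fderiv_fun_const_smul (hG.differentiableAt_localChristoffel u v) c

lemma fderiv_localChristoffel_smul_right (hG : IsLocalMetric G y) (c : ℝ) (u v : E) :
    fderiv ℝ (fun z => localChristoffel G z u (c • v)) y =
      c • fderiv ℝ (fun z => localChristoffel G z u v) y := by
  simp only [localChristoffel_smul_right]
  exact fderiv_fun_const_smul (hG.differentiableAt_localChristoffel u v) c

lemma localCurvature_add_middle (hG : IsLocalMetric G y) (u v v' w : E) :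
    localCurvature G y u (v + v') w = localCurvature G y u v w + localCurvature G y u v' w := by
  simp only [localCurvature, hG.fderiv_localChristoffel_add_left]
  simp only [localChristoffel_add_left,
    localChristoffel_add_right, map_add, add_apply]
  abel

lemma localCurvature_smul_middle (hG : IsLocalMetric G y) (c : ℝ) (u v w : E) :
    localCurvature G y u (c • v) w = c • localCurvature G y u v w := by
  simp only [localCurvature, hG.fderiv_localChristoffel_smul_left]
  simp only [localChristoffel_smul_left,
    localChristoffel_smul_right, map_smul, smul_apply, smul_sub, smul_add]

lemma localCurvature_add_right (hG : IsLocalMetric G y) (u v w w' : E) :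
    localCurvature G y u v (w + w') = localCurvature G y u v w + localCurvature G y u v w' := by
  simp only [localCurvature, hG.fderiv_localChristoffel_add_right]
  simp only [localChristoffel_add_right, add_apply]
  abel

lemma localCurvature_smul_right (hG : IsLocalMetric G y) (c : ℝ) (u v w : E) :
    localCurvature G y u v (c • w) = c • localCurvature G y u v w := by
  simp only [localCurvature, hG.fderiv_localChristoffel_smul_right]
  simp only [localChristoffel_smul_right, smul_apply, smul_sub, smul_add]

end IsLocalMetric

end LocalMetric

/-! ### Conformal change of connection and curvature -/

section ConformalChange

variable {E : Type*} [NormedAddCommGroup E] [NormedSpace ℝ E]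

namespace IsLocalMetric

variable {G : E → E →L[ℝ] E →L[ℝ] ℝ} {y : E} {H : E → ℝ}

/-- Here `a` is half the logarithmic derivative of `H`, and `(G y).inverse a` is its dual vector.
Both sides are compared through the Koszul formula, by nondegeneracy of `H • G`. -/
lemma localChristoffel_smul (hG : IsLocalMetric G y) (hG' : IsLocalMetric (fun z => H z • G z) y)
    (hH : DifferentiableAt ℝ H y) {a : E →L[ℝ] ℝ} (ha : ∀ w, fderiv ℝ H y w = 2 * H y * a w) (u v : E) :
    localChristoffel (fun z => H z • G z) y u v =
      localChristoffel G y u v + (a u • v + a v • u - G y u v • (G y).inverse a) := by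
  have key : ∀ u v w, fderiv ℝ (fun z => H z • G z) y u v w =
      H y * fderiv ℝ G y u v w + 2 * H y * a u * G y v w := by
    intro u v w
    have h₁ := hH.hasFDerivAt.mul
      ((hG.contDiffAt_apply v w).differentiableAt (by simp)).hasFDerivAt
    rw [hG'.fderiv_apply, hG.fderiv_apply]
    have h₂ : (fun z => (H z • G z) v w) = (H * fun z => G z v w) := by
      ext z; simp
    rw [h₂, h₁.fderiv]
    simp [ha]
    ring
  refine hG'.eq_of_apply_eq fun w => ?_
  rw [hG'.apply_localChristoffel, key, key, key]
  simp only [smul_apply, map_add, map_sub, map_smul, add_apply, sub_apply,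
    hG.apply_localChristoffel, hG.apply_inverse, smul_eq_mul]
  rw [hG.symm u w, hG.symm v w]
  ring

variable [FiniteDimensional ℝ E]

/-- If two connections differ by the tensor of a conformal change with logarithmic derivative `a`,
their curvatures differ as follows on orthogonal vectors. -/
lemma localCurvature_of_christoffel_eq (hG : IsLocalMetric G y) {G' : E → E →L[ℝ] E →L[ℝ] ℝ}
    {a : E → E →L[ℝ] ℝ} (ha : DifferentiableAt ℝ a y)
    (h : ∀ᶠ z in 𝓝 y, ∀ u v, localChristoffel G' z u v =
      localChristoffel G z u v + (a z u • v + a z v • u - G z u v • (G z).inverse (a z)))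
    {u v : E} (huv : G y u v = 0) :
    G y (localCurvature G' y u v v) u = G y (localCurvature G y u v v) u
      - G y v v * (fderiv ℝ a y u u - a y (localChristoffel G y u u))
      - G y u u * (fderiv ℝ a y v v - a y (localChristoffel G y v v))
      + G y v v * a y u ^ 2 + G y u u * a y v ^ 2
      - G y u u * G y v v * a y ((G y).inverse (a y)) := by
  have hA := hG.differentiableAt_inverse ha
  set A : E → E := fun z => (G z).inverse (a z) with hA_def
  have apply_A : ∀ᶠ z in 𝓝 y, ∀ w, G z (A z) w = a z w :=
    hG.eventually_nhds.mono fun z hz w => hz.apply_inverse _ _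
  -- Differentiating `G(A, w) = a(w)` avoids a formula for the derivative of the inverse.
  have apply_fderiv_A : ∀ x w, G y (fderiv ℝ A y x) w =
      fderiv ℝ a y x w - fderiv ℝ G y x (A y) w := by
    intro x w
    have h₁ : (fun z => G z (A z) w) =ᶠ[𝓝 y] fun z => a z w := apply_A.mono fun z hz => hz w
    have h₂ := DFunLike.congr_fun (h₁.fderiv_eq (𝕜 := ℝ)) x
    rw [hG.fderiv_apply_apply hA.hasFDerivAt (hasFDerivAt_const w y),
      (ha.hasFDerivAt.clm_apply (hasFDerivAt_const w y)).fderiv] at h₂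
    simp at h₂
    linarith
  have deriv_christoffel : ∀ x v w, fderiv ℝ (fun z => localChristoffel G' z v w) y x =
      fderiv ℝ (fun z => localChristoffel G z v w) y x + (fderiv ℝ a y x v • w
        + fderiv ℝ a y x w • v - (fderiv ℝ G y x v w • A y + G y v w • fderiv ℝ A y x)) := by
    intro x v w
    have h₁ := h.mono fun z hz => hz v w
    have h₂ : ∀ v, HasFDerivAt (fun z => a z v) ((fderiv ℝ a y).flip v) y := fun v => by
      simpa using ha.hasFDerivAt.clm_apply (hasFDerivAt_const v y)
    have h₃ := ((hG.contDiffAt_apply v w).differentiableAt (by simp)).hasFDerivAt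
    have h₄ := (hG.differentiableAt_localChristoffel v w).hasFDerivAt.add
      ((((h₂ v).smul (hasFDerivAt_const w y)).add ((h₂ w).smul (hasFDerivAt_const v y))).sub
        (h₃.smul hA.hasFDerivAt))
    rw [EventuallyEq.fderiv_eq (𝕜 := ℝ) h₁]
    refine (DFunLike.congr_fun h₄.fderiv x).trans ?_
    rw [hG.fderiv_apply]
    simp
    abel
  have hy := h.self_of_nhds
  have hAy : ∀ w, G y (A y) w = a y w := apply_A.self_of_nhds
  have hvu : G y v u = 0 := by rw [hG.symm, huv]
  change ∀ u v, localChristoffel G' y u v =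
      localChristoffel G y u v + (a y u • v + a y v • u - G y u v • A y) at hy
  change _ = _ - _ - _ + _ + _ - G y u u * G y v v * a y (A y)
  have hAy' : ∀ w, G y w (A y) = a y w := fun w => by rw [hG.symm, hAy]
  simp only [localCurvature, deriv_christoffel, hy, map_add, map_sub, map_smul, add_apply,
    sub_apply, smul_apply, smul_eq_mul, localChristoffel_add_right, localChristoffel_sub_right,
    localChristoffel_smul_right, apply_fderiv_A, hG.fderiv_eq, hAy, hAy', huv, hvu]
  -- Symmetry of `G` and of the connection brings the remaining Christoffel terms to a common form,
  -- so that they cancel.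
  rw [hG.symm v (localChristoffel G y u v), hG.localChristoffel_comm v u]
  ring

end IsLocalMetric

end ConformalChange

/-! ### Metrics read in the preferred chart -/

section InChart

variable {E : Type*} [NormedAddCommGroup E] [NormedSpace ℝ E]

/-- Definiteness gives injectivity, and `E` and its dual have the same dimension. -/
lemma ContinuousLinearMap.isInvertible_of_apply_self_pos [FiniteDimensional ℝ E]
    {B : E →L[ℝ] E →L[ℝ] ℝ} (hB : ∀ v, v ≠ 0 → 0 < B v v) : B.IsInvertible := by
  have hinj : Function.Injective (B : E →ₗ[ℝ] E →L[ℝ] ℝ) := by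
    refine (injective_iff_map_eq_zero _).2 fun v hv => ?_
    by_contra h
    have h' : B v = 0 := hv
    simpa [h'] using hB v h
  have hrank : Module.finrank ℝ E = Module.finrank ℝ (E →L[ℝ] ℝ) := by
    rw [← (LinearMap.toContinuousLinearMap (𝕜 := ℝ) (E := E) (F' := ℝ)).finrank_eq]
    exact Subspace.dual_finrank_eq.symm
  refine ⟨(LinearEquiv.ofInjectiveOfFinrankEq (B : E →ₗ[ℝ] E →L[ℝ] ℝ) hinj
    hrank).toContinuousLinearEquiv, ?_⟩
  ext v w
  rfl

variable {M : Type*} [TopologicalSpace M] [ChartedSpace E M]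

lemma ContMDiff.mvfderiv_apply_eq {f : M → ℝ}
    (hf : ContMDiff 𝓘(ℝ, E) 𝓘(ℝ, ℝ) ∞ f) (x : M) (v : TangentSpace 𝓘(ℝ, E) x) :
    mvfderiv 𝓘(ℝ, E) f x v =
      fderiv ℝ (f ∘ (extChartAt 𝓘(ℝ, E) x).symm) (extChartAt 𝓘(ℝ, E) x x) v := by
  have h := (hf.mdifferentiable (by simp)) x
  simp only [mvfderiv, h.mfderiv, writtenInExtChartAt]
  simp
  rfl

variable [IsManifold 𝓘(ℝ, E) ∞ M]

namespace SmoothMetric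

variable (g : SmoothMetric E M) (x : M)

lemma inChart_apply (y u v : E) : g.inChart x y u v =
    g.inner ((extChartAt 𝓘(ℝ, E) x).symm y)
      (mfderiv 𝓘(ℝ, E) 𝓘(ℝ, E) (extChartAt 𝓘(ℝ, E) x).symm y u)
      (mfderiv 𝓘(ℝ, E) 𝓘(ℝ, E) (extChartAt 𝓘(ℝ, E) x).symm y v) :=
  rfl

lemma inChart_extChartAt_apply (u v : TangentSpace 𝓘(ℝ, E) x) :
    g.inChart x (extChartAt 𝓘(ℝ, E) x x) u v = g.inner x u v := by
  have h := mfderivWithin_range_extChartAt_symm (I := 𝓘(ℝ, E)) (x := x)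
  simp only [ModelWithCorners.range_eq_univ, mfderivWithin_univ] at h
  -- The type of `g.inner p` depends on `p`; with vectors taken in `E`, the base point can be
  -- substituted.
  have h' : ∀ (p : M), p = x → ∀ u v : E, g.inner p u v = g.inner x u v := by
    rintro p rfl u v; rfl
  refine (g.inChart_apply x _ u v).trans ?_
  rw [h]
  exact h' _ (extChartAt_to_inv x) u v

lemma inChart_symm (y u v : E) : g.inChart x y u v = g.inChart x y v u := by
  rw [inChart_apply, inChart_apply]
  exact g.symm _ (mfderiv 𝓘(ℝ, E) 𝓘(ℝ, E) (extChartAt 𝓘(ℝ, E) x).symm y u) _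

lemma inChart_pos {y : E} (hy : y ∈ (extChartAt 𝓘(ℝ, E) x).target) {v : E} (hv : v ≠ 0) :
    0 < g.inChart x y v v := by
  have h := isInvertible_mfderivWithin_extChartAt_symm (I := 𝓘(ℝ, E)) hy
  simp only [ModelWithCorners.range_eq_univ, mfderivWithin_univ] at h
  refine g.pos _ _ fun h0 => hv ?_
  exact h.injective (h0.trans (map_zero _).symm)

lemma contDiffOn_inChart_apply (u v : E) :
    ContDiffOn ℝ 2 (fun y => g.inChart x y u v) (extChartAt 𝓘(ℝ, E) x).target := by
  set φ := extChartAt 𝓘(ℝ, E) x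
  have hopen : IsOpen φ.target := isOpen_extChartAt_target x
  have hφ : ContMDiffOn 𝓘(ℝ, E) 𝓘(ℝ, E) ∞ φ.symm φ.target := contMDiffOn_extChartAt_symm x
  have hD : ∀ u : E, ContMDiffOn 𝓘(ℝ, E) 𝓘(ℝ, E).tangent 2
      (fun y => (⟨φ.symm y, mfderiv 𝓘(ℝ, E) 𝓘(ℝ, E) φ.symm y u⟩ : TangentBundle 𝓘(ℝ, E) M))
      φ.target := by
    intro u
    -- The coordinate field is the image of the constant field `u` under the tangent map of the
    -- inverse chart.
    have h₁ := hφ.contMDiffOn_tangentMapWithin (m := 2) (by norm_cast) hopen.uniqueMDiffOn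
    have h₂ : ContMDiff 𝓘(ℝ, E) 𝓘(ℝ, E).tangent 2
        (fun y : E => (⟨y, u⟩ : TangentBundle 𝓘(ℝ, E) E)) :=
      contMDiff_vectorSpace_iff_contDiff.2 contDiff_const
    refine (h₁.comp h₂.contMDiffOn fun y hy => hy).congr fun y hy => ?_
    simp only [Function.comp, tangentMapWithin, mfderivWithin_of_isOpen hopen hy]
  intro y hy
  have h : ContMDiffWithinAt 𝓘(ℝ, E) (𝓘(ℝ, E).prod 𝓘(ℝ, ℝ)) 2
      (fun y ↦ TotalSpace.mk' ℝ (E := Bundle.Trivial M ℝ) (φ.symm y)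
        (g.inner (φ.symm y) (mfderiv 𝓘(ℝ, E) 𝓘(ℝ, E) φ.symm y u)
          (mfderiv 𝓘(ℝ, E) 𝓘(ℝ, E) φ.symm y v))) φ.target y := by
    apply ContMDiffWithinAt.clm_bundle_apply₂ (F₁ := E) (F₂ := E)
    · exact ContMDiffAt.comp_contMDiffWithinAt y (g.contMDiff.contMDiffAt.of_le (by norm_cast))
        ((hφ y hy).of_le (by norm_cast))
    · exact hD u y hy
    · exact hD v y hy
  simp only [contMDiffWithinAt_totalSpace] at h
  exact h.2.contDiffWithinAt

variable [FiniteDimensional ℝ E]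

lemma isLocalMetric_inChart :
    IsLocalMetric (g.inChart x) (extChartAt 𝓘(ℝ, E) x x) where
  contDiffAt := by
    have h : ContDiffOn ℝ 2 (g.inChart x) (extChartAt 𝓘(ℝ, E) x).target :=
      contDiffOn_clm_apply.2 fun u => contDiffOn_clm_apply.2 fun v =>
        g.contDiffOn_inChart_apply x u v
    exact h.contDiffAt (extChartAt_target_mem_nhds x)
  eventually_symm := Eventually.of_forall fun y u v => g.inChart_symm x y u v
  eventually_isInvertible := by
    filter_upwards [extChartAt_target_mem_nhds x] with y hy
    exact ContinuousLinearMap.isInvertible_of_apply_self_pos fun v hv => g.inChart_pos x hy hv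

end SmoothMetric

lemma ContMDiff.contDiffAt_comp_extChartAt_symm {f : M → ℝ}
    (hf : ContMDiff 𝓘(ℝ, E) 𝓘(ℝ, ℝ) ∞ f) (x : M) :
    ContDiffAt ℝ ∞ (f ∘ (extChartAt 𝓘(ℝ, E) x).symm) (extChartAt 𝓘(ℝ, E) x x) :=
  ((hf.comp_contMDiffOn (contMDiffOn_extChartAt_symm x)).contMDiffAt
    (extChartAt_target_mem_nhds x)).contDiffAt

end InChart

/-! ### Curvature form under a change of basis of a plane -/

section CurvatureForm

variable {E : Type*} [NormedAddCommGroup E] [NormedSpace ℝ E] [FiniteDimensional ℝ E]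

namespace IsLocalMetric

variable {G : E → E →L[ℝ] E →L[ℝ] ℝ} {y : E}

/-- Skewness in each pair of arguments suffices for this case of pair symmetry; the Bianchi identity
is not needed. -/
lemma curvature_form_comm (hG : IsLocalMetric G y) (u v : E) :
    G y (localCurvature G y u v v) u = G y (localCurvature G y v u u) v := by
  rw [hG.localCurvature_skew, localCurvature_comm G y v u u, map_neg, neg_apply,
    hG.symm (localCurvature G y u v u)]

lemma curvature_form_smul_right (hG : IsLocalMetric G y) (t : ℝ) (u v : E) :
    G y (localCurvature G y u (t • v) (t • v)) u =
      t ^ 2 * G y (localCurvature G y u v v) u := by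
  rw [hG.localCurvature_smul_middle, hG.localCurvature_smul_right]
  simp only [map_smul, smul_apply, smul_eq_mul]
  ring

lemma curvature_form_smul_left (hG : IsLocalMetric G y) (t : ℝ) (u v : E) :
    G y (localCurvature G y (t • u) v v) (t • u) =
      t ^ 2 * G y (localCurvature G y u v v) u := by
  rw [hG.curvature_form_comm, hG.curvature_form_smul_right, hG.curvature_form_comm]

lemma curvature_form_add_smul (hG : IsLocalMetric G y) (t : ℝ) (u v : E) :
    G y (localCurvature G y u (v + t • u) (v + t • u)) u =
      G y (localCurvature G y u v v) u := by
  have h₁ : localCurvature G y u u = 0 := by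
    ext w
    simp [localCurvature]
  have h₂ : G y (localCurvature G y u v u) u = 0 := by
    have := hG.localCurvature_skew u v u u
    rw [hG.symm u] at this
    linarith
  rw [hG.localCurvature_add_middle, hG.localCurvature_smul_middle, h₁,
    hG.localCurvature_add_right, hG.localCurvature_smul_right]
  simp [h₂]

/-- This is the base change of Gram–Schmidt: it multiplies the form by a square, so the sign is
preserved. -/
lemma curvature_form_smul_add_smul (hG : IsLocalMetric G y) (s t c : ℝ) (u v : E) :
    G y (localCurvature G y (s • u) (t • (v + c • u)) (t • (v + c • u))) (s • u) =
      s ^ 2 * t ^ 2 * G y (localCurvature G y u v v) u := by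
  rw [hG.curvature_form_smul_left, hG.curvature_form_smul_right, hG.curvature_form_add_smul,
    mul_assoc]

end IsLocalMetric

end CurvatureForm

/-! ### Orthonormal pairs and the sign of sectional curvature -/

section OrthonormalPair

variable {E : Type*} [NormedAddCommGroup E] [NormedSpace ℝ E]
variable {M : Type*} [TopologicalSpace M] [ChartedSpace E M] [IsManifold 𝓘(ℝ, E) ∞ M]

namespace SmoothMetric

variable (g : SmoothMetric E M) (x : M)

/-- Gram–Schmidt with explicit coefficients, to match `curvature_form_smul_add_smul`. The last
clause yields positivity of the Gram determinant. -/
lemma exists_orthonormal_pair {u v : TangentSpace 𝓘(ℝ, E) x} (h : LinearIndependent ℝ ![u, v]) :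
    ∃ s t c : ℝ, 0 < s ∧ 0 < t ∧ g.inner x (s • u) (s • u) = 1 ∧
      g.inner x (t • (v + c • u)) (t • (v + c • u)) = 1 ∧
      g.inner x (s • u) (t • (v + c • u)) = 0 ∧
      s ^ 2 * t ^ 2 * (g.inner x u u * g.inner x v v - g.inner x u v ^ 2) = 1 := by
  have hu : u ≠ 0 := by simpa using h.ne_zero 0
  have hU := g.pos x u hu
  set c := -(g.inner x u v / g.inner x u u) with hc
  have hv : v + c • u ≠ 0 := by
    intro h0
    have := (LinearIndependent.pair_iff.1 h c 1 (by rw [one_smul, add_comm]; exact h0)).2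
    exact one_ne_zero this
  have hV := g.pos x _ hv
  have normalize : ∀ a : ℝ, 0 < a → ∃ s : ℝ, 0 < s ∧ s ^ 2 * a = 1 := fun a ha =>
    ⟨(Real.sqrt a)⁻¹, by positivity, by rw [inv_pow, Real.sq_sqrt ha.le, inv_mul_cancel₀ ha.ne']⟩
  obtain ⟨s, hs, h₁⟩ := normalize _ hU
  obtain ⟨t, ht, h₂⟩ := normalize _ hV
  have hcu : c * g.inner x u u = - g.inner x u v := by
    rw [hc]; field_simp
  have h₃ := h₂
  simp only [map_add, map_smul, add_apply, smul_apply, smul_eq_mul, g.symm x v u] at h₃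
  refine ⟨s, t, c, hs, ht, ?_, ?_, ?_, ?_⟩
  · rw [map_smul, map_smul, smul_apply, smul_eq_mul, smul_eq_mul, ← mul_assoc, ← sq, h₁]
  · rw [map_smul, map_smul, smul_apply, smul_eq_mul, smul_eq_mul, ← mul_assoc, ← sq, h₂]
  · simp only [map_add, map_smul, smul_apply, smul_eq_mul]
    linear_combination s * t * hcu
  · linear_combination h₁ + s ^ 2 * g.inner x u u * h₃
      - s ^ 2 * t ^ 2 * (g.inner x u v + c * g.inner x u u) * hcu

lemma linearIndependent_of_orthonormal {e f : TangentSpace 𝓘(ℝ, E) x} (he : g.inner x e e = 1)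
    (hf : g.inner x f f = 1) (hef : g.inner x e f = 0) : LinearIndependent ℝ ![e, f] := by
  refine LinearIndependent.pair_iff.2 fun s t h => ?_
  have h₁ := congrArg (g.inner x e) h
  have h₂ := congrArg (g.inner x f) h
  simp only [map_add, map_smul, smul_eq_mul, he, hf, hef, g.symm x f e, map_zero] at h₁ h₂
  constructor <;> linarith

lemma inner_curvature (u v w z : TangentSpace 𝓘(ℝ, E) x) :
    g.inner x (g.curvature x u v w) z =
      g.inChart x (extChartAt 𝓘(ℝ, E) x x)
        (localCurvature (g.inChart x) (extChartAt 𝓘(ℝ, E) x x) u v w) z :=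
  (g.inChart_extChartAt_apply x _ _).symm

variable [FiniteDimensional ℝ E]

/-- It suffices to check the sign of the sectional curvature on pairs that are orthonormal for some
auxiliary metric `g₀`. -/
lemma hasNegativeSectionalCurvature_of_orthonormal (g₀ : SmoothMetric E M)
    (h : ∀ (x : M) (e f : TangentSpace 𝓘(ℝ, E) x), g₀.inner x e e = 1 → g₀.inner x f f = 1 →
      g₀.inner x e f = 0 → g.inner x (g.curvature x e f f) e < 0) :
    g.HasNegativeSectionalCurvature := by
  intro x u v huv
  obtain ⟨s, t, c, hs, ht, he, hf, hef, -⟩ := g₀.exists_orthonormal_pair x huv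
  -- The `g₀`-orthonormal pair decides the sign of the numerator; the `g`-orthonormal one only shows
  -- that the denominator is positive.
  obtain ⟨s', t', -, -, -, -, -, -, hst'⟩ := g.exists_orthonormal_pair x huv
  have hG := g.isLocalMetric_inChart x
  have key := h x _ _ he hf hef
  rw [g.inner_curvature] at key
  have key' := (hG.curvature_form_smul_add_smul s t c u v).symm.trans_lt key
  have hpos : 0 < s ^ 2 * t ^ 2 := by positivity
  unfold sectionalCurvature
  rw [g.inner_curvature]
  refine div_neg_of_neg_of_pos ?_ ?_
  · by_contra h0
    exact absurd key' (not_lt.2 (mul_nonneg hpos.le (not_lt.1 h0)))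
  · exact pos_of_mul_pos_right (by rw [hst']; exact one_pos) (by positivity)

lemma sectionalCurvature_comm (u v : TangentSpace 𝓘(ℝ, E) x) :
    g.sectionalCurvature x u v = g.sectionalCurvature x v u := by
  unfold sectionalCurvature
  rw [g.inner_curvature, g.inner_curvature]
  congr 1
  · exact (g.isLocalMetric_inChart x).curvature_form_comm u v
  · rw [g.symm x u v]
    ring

lemma normSqDifferential_eq {f : M → ℝ} (hf : ContMDiff 𝓘(ℝ, E) 𝓘(ℝ, ℝ) ∞ f) :
    g.normSqDifferential f x =
      fderiv ℝ (f ∘ (extChartAt 𝓘(ℝ, E) x).symm) (extChartAt 𝓘(ℝ, E) x x)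
        ((g.inChart x (extChartAt 𝓘(ℝ, E) x x)).inverse
          (fderiv ℝ (f ∘ (extChartAt 𝓘(ℝ, E) x).symm) (extChartAt 𝓘(ℝ, E) x x))) := by
  have hG := g.isLocalMetric_inChart x
  let B : E →L[ℝ] E →L[ℝ] ℝ := g.inner x
  have h₁ : B.IsInvertible := ContinuousLinearMap.isInvertible_of_apply_self_pos (g.pos x)
  have h₂ : ∀ w, g.inner x (g.gradient f x) w =
      fderiv ℝ (f ∘ (extChartAt 𝓘(ℝ, E) x).symm) (extChartAt 𝓘(ℝ, E) x x) w := fun w => by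
    rw [← hf.mvfderiv_apply_eq]
    exact DFunLike.congr_fun (h₁.self_apply_inverse (mvfderiv 𝓘(ℝ, E) f x)) w
  have h₃ : g.gradient f x = (g.inChart x (extChartAt 𝓘(ℝ, E) x x)).inverse
      (fderiv ℝ (f ∘ (extChartAt 𝓘(ℝ, E) x).symm) (extChartAt 𝓘(ℝ, E) x x)) :=
    hG.eq_of_apply_eq fun w => by
      rw [hG.apply_inverse]
      exact (g.inChart_extChartAt_apply x _ w).trans (h₂ w)
  unfold normSqDifferential
  rw [h₂, h₃]

end SmoothMetric

end OrthonormalPair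

/-! ### The conformal factor `1 / k + r` -/

section ConformalMetric

variable {E : Type*} [NormedAddCommGroup E] [NormedSpace ℝ E]
variable {M : Type*} [TopologicalSpace M] [ChartedSpace E M] [IsManifold 𝓘(ℝ, E) ∞ M]

namespace SmoothMetric

lemma inChart_conformal (g : SmoothMetric E M) (h : M → ℝ)
    (hh : ContMDiff 𝓘(ℝ, E) 𝓘(ℝ, ℝ) ∞ h) (hpos : ∀ x, 0 < h x) (x : M) :
    (g.conformal h hh hpos).inChart x =
      fun z => h ((extChartAt 𝓘(ℝ, E) x).symm z) • g.inChart x z := by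
  ext z u v
  rfl

end SmoothMetric

lemma one_add_mul_pos_of_one_div_add_pos {a r : ℝ} (ha : 0 < a) (h : 0 < 1 / a + r) :
    0 < 1 + r * a := by
  have := mul_pos ha h
  rwa [mul_add, mul_one_div_cancel ha.ne', mul_comm] at this

variable [FiniteDimensional ℝ E]

/-- The curvature of `(1 / κ + r) G` on a pair of orthonormal vectors. -/
lemma IsLocalMetric.localCurvature_one_div_add_smul {G : E → E →L[ℝ] E →L[ℝ] ℝ} {y : E}
    (hG : IsLocalMetric G y) {κ : E → ℝ} {r : ℝ} (hκ : ContDiffAt ℝ ∞ κ y)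
    (hκ_pos : ∀ z, 0 < κ z) (hr : ∀ z, 0 < 1 / κ z + r)
    (hG' : IsLocalMetric (fun z => (1 / κ z + r) • G z) y) {u v : E}
    (hu : G y u u = 1) (hv : G y v v = 1) (huv : G y u v = 0) :
    2 * κ y * (1 + r * κ y) *
      G y (localCurvature (fun z => (1 / κ z + r) • G z) y u v v) u =
    localHessian G κ y u u + localHessian G κ y v v
      - (1 + 4 * r * κ y) / (2 * κ y * (1 + r * κ y)) *
        (fderiv ℝ κ y u ^ 2 + fderiv ℝ κ y v ^ 2)
      - 1 / (2 * κ y * (1 + r * κ y)) * fderiv ℝ κ y ((G y).inverse (fderiv ℝ κ y))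
      + 2 * κ y * (1 + r * κ y) * G y (localCurvature G y u v v) u := by
  have hm : ∀ z, 0 < 1 + r * κ z := fun z =>
    one_add_mul_pos_of_one_div_add_pos (hκ_pos z) (hr z)
  -- For `H = 1 / κ + r`, `dH / (2H) = c dκ`.
  set c : E → ℝ := fun z => -(2 * (κ z * (1 + r * κ z)))⁻¹ with hc
  set a : E → E →L[ℝ] ℝ := fun z => c z • fderiv ℝ κ z with ha
  have hκ' : DifferentiableAt ℝ κ y := hκ.differentiableAt (by simp)
  have hκ'' : DifferentiableAt ℝ (fderiv ℝ κ) y :=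
    (hκ.fderiv_right (m := 1) (by norm_cast)).differentiableAt (by simp)
  have hne : 2 * (κ y * (1 + r * κ y)) ≠ 0 := (mul_pos two_pos (mul_pos (hκ_pos y) (hm y))).ne'
  have hc' : HasFDerivAt c
      (((1 + 2 * r * κ y) / (2 * (κ y * (1 + r * κ y)) ^ 2)) • fderiv ℝ κ y) y := by
    have h₁ := ((hκ'.hasFDerivAt.mul ((hκ'.hasFDerivAt.const_mul r).const_add 1)).const_mul 2)
    have h₂ := ((hasDerivAt_inv hne).comp_hasFDerivAt y h₁).neg
    refine h₂.congr_fderiv ?_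
    have := (hκ_pos y).ne'
    have : 1 + κ y * r ≠ 0 := mul_comm r (κ y) ▸ (hm y).ne'
    ext w
    simp
    field_simp
    ring
  have ha' : HasFDerivAt a _ y := hc'.smul hκ''.hasFDerivAt
  have hev : ∀ᶠ z in 𝓝 y, ∀ u v, localChristoffel (fun z => (1 / κ z + r) • G z) z u v =
      localChristoffel G z u v + (a z u • v + a z v • u - G z u v • (G z).inverse (a z)) := by
    filter_upwards [hG.eventually_nhds, hG'.eventually_nhds,
      (hκ.of_le (m := 1) (by norm_cast)).eventually (by simp)] with z h₁ h₂ h₃ u v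
    have h₄ := h₃.differentiableAt (by simp)
    have h₅ : HasFDerivAt (fun z => 1 / κ z + r) (-((κ z) ^ 2)⁻¹ • fderiv ℝ κ z) z := by
      simp only [one_div]
      exact ((hasDerivAt_inv (hκ_pos z).ne').comp_hasFDerivAt z h₄.hasFDerivAt).add_const r
    refine h₁.localChristoffel_smul h₂ h₅.differentiableAt (fun w => ?_) u v
    rw [h₅.fderiv]
    have := (hκ_pos z).ne'
    have : 1 + κ z * r ≠ 0 := mul_comm r (κ z) ▸ (hm z).ne'
    simp only [ha, hc, smul_apply, smul_eq_mul]
    field_simp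
  rw [hG.localCurvature_of_christoffel_eq ha'.differentiableAt hev huv, ha'.fderiv, hu, hv]
  have := (hκ_pos y).ne'
  have : 1 + κ y * r ≠ 0 := mul_comm r (κ y) ▸ (hm y).ne'
  simp only [ha, hc, localHessian, map_smul, smul_apply, add_apply, smul_eq_mul,
    ContinuousLinearMap.smulRight_apply]
  -- With `P = κ (1 + r κ)`, the squares of `dκ(u)` and `dκ(v)` get the coefficient `c² - (1 + 2rκ)
  -- / (2P²) = -(1 + 4rκ) / (4P²)`, and the norm term gets `-c² = -1 / (4P²)`.
  field_simp
  ring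

end ConformalMetric

theorem lemma5p1 {E : Type*} [NormedAddCommGroup E] [NormedSpace ℝ E] [FiniteDimensional ℝ E]
    {M₁ : Type*} [TopologicalSpace M₁] [ChartedSpace E M₁] [IsManifold 𝓘(ℝ, E) ∞ M₁]
    (hdim : 1 < Module.finrank ℝ E)
    (g₁ : SmoothMetric E M₁) (hg₁ : g₁.HasNegativeSectionalCurvature)
    (k : M₁ → ℝ) (hk : ContMDiff 𝓘(ℝ, E) 𝓘(ℝ, ℝ) ∞ k) (hpos : ∃ c > 0, ∀ x, c ≤ k x)
    (r : ℝ) (hr : lowerParameter k < r) (hne : HessianInequality g₁ k r) :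
    (metricG g₁ k hk hpos r hr).HasNegativeSectionalCurvature := by
  refine SmoothMetric.hasNegativeSectionalCurvature_of_orthonormal _ g₁ fun x e f he hf hef => ?_
  obtain ⟨c, hc, hck⟩ := hpos
  have hk_pos : ∀ p, 0 < k p := fun p => hc.trans_le (hck p)
  have hh_pos : ∀ p, 0 < 1 / k p + r := inv_add_pos_of_lowerParameter_lt ⟨c, hc, hck⟩ hr
  have hm := one_add_mul_pos_of_one_div_add_pos (hk_pos x) (hh_pos x)
  have hG := g₁.isLocalMetric_inChart x
  have hG' := (metricG g₁ k hk ⟨c, hc, hck⟩ r hr).isLocalMetric_inChart x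
  have hconf : (metricG g₁ k hk ⟨c, hc, hck⟩ r hr).inChart x =
      fun z => (1 / (k ∘ (extChartAt 𝓘(ℝ, E) x).symm) z + r) • g₁.inChart x z :=
    g₁.inChart_conformal _ _ _ x
  have hκx : (k ∘ (extChartAt 𝓘(ℝ, E) x).symm) (extChartAt 𝓘(ℝ, E) x x) = k x :=
    congrArg k (extChartAt_to_inv x)
  rw [SmoothMetric.inner_curvature]
  rw [hconf] at hG' ⊢
  have key := hG.localCurvature_one_div_add_smul (hk.contDiffAt_comp_extChartAt_symm x)
    (fun z => hk_pos _) (fun z => hh_pos _) hG'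
    ((g₁.inChart_extChartAt_apply x e e).trans he) ((g₁.inChart_extChartAt_apply x f f).trans hf)
    ((g₁.inChart_extChartAt_apply x e f).trans hef)
  have hfe : g₁.inner x f e = 0 := (g₁.symm x f e).trans hef
  -- The hypothesis is used for both unit vectors of the same plane; the sum of the two bounds
  -- matches `key`.
  have h₁ := hne x e f he (g₁.linearIndependent_of_orthonormal x he hf hef)
  have h₂ := hne x f e hf (g₁.linearIndependent_of_orthonormal x hf he hfe)
  have hK : g₁.sectionalCurvature x e f = g₁.inChart x (extChartAt 𝓘(ℝ, E) x x)
      (localCurvature (g₁.inChart x) (extChartAt 𝓘(ℝ, E) x x) e f f) e := by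
    rw [SmoothMetric.sectionalCurvature, g₁.inner_curvature, he, hf, hef]
    norm_num
  rw [g₁.sectionalCurvature_comm x f e] at h₂
  rw [hK, hk.mvfderiv_apply_eq, g₁.normSqDifferential_eq x hk] at h₁ h₂
  unfold SmoothMetric.hessian at h₁ h₂
  rw [hκx] at key
  -- The pairing with `G_r` is `1 / k + r` times the pairing with `g₁`.
  refine mul_neg_of_pos_of_neg (hh_pos _) ?_
  have hden : 1 / (2 * k x * (1 + r * k x)) = 2 * (1 / (4 * k x * (1 + r * k x))) := by
    field_simp
    norm_num
  rw [hden] at key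
  have hpos : 0 < 2 * k x * (1 + r * k x) := mul_pos (mul_pos two_pos (hk_pos x)) hm
  refine (pos_iff_neg_of_mul_neg ?_).1 hpos
  refine key.trans_lt ?_
  linarith
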